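/- Let $d,N\in\mathbf N$ and $\varepsilon>0$. Consider $N$ hard spheres of diameter $\varepsilon$ in $\mathbf R^d$, with positions $x_1,\dots,x_N$ and velocities $v_1,\dots,v_N$, and let $$\mathcal D_N=\{Z_N=(x_i,v_i)_{1\le i\le N}\in\mathbf R^{2dN} : |x_i-x_j|>\varepsilon \text{ for all } i\ne j\}.$$ A trajectory starting from $Z_N\in\mathcal D_N$ is a motion with continuous positions and $|x_i-x_j|\ge\varepsilon$ for $i\neq j$, in free flow ($\dot x_i=v_i$, $\dot v_i=0$) as long as no two particles are in contact, and reflected elastically at contacts: if $|x_i-x_j|=\varepsilon$ and $\nu^{i,j}=(x_i-x_j)/|x_i-x_j|$, the velocities $v_i,v_j$ just before the contact are replaced by $$v_i-\nu^{i,j}\cdot(v_i-v_j)\,\nu^{i,j},\qquad v_j+\nu^{i,j}\cdot(v_i-v_j)\,\nu^{i,j},$$ while the velocity of a particle that touches no other one does not change. The trajectory is pathological if, at some time, a particle is in contact with two others (a collision of more than two particles), or a collision is grazing ($\nu^{i,j}\cdot(v_i-v_j)=0$), or if there are infinitely many collision times in a finite time interval; trajectories are not continued beyond such an event. Then the set of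 initial configurations $Z_N\in\mathcal D_N$ that lead, forward or backward in time, to a pathological trajectory has Lebesgue measure zero in $\mathbf R^{2dN}$. Moreover, for almost every $Z_N\in\mathcal D_N$ the trajectory starting from $Z_N$ exists for all times, forward and backward, and is unique. (The backward trajectory is the forward one of the configuration with all velocities reversed.) -/

import Mathlib

open MeasureTheory Set

noncomputable section

namespace HardSphere

/-- Physical space `ℝ^d` with its Euclidean structure. -/
abbrev Space (d : ℕ) := EuclideanSpace ℝ (Fin d)

/-- Phase space `ℝ^{2dN}`: a pair `(X, V)` of the `N` positions and the `N` velocities.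
Its canonical measure `volume` is Lebesgue measure. -/
abbrev Phase (d N : ℕ) := (Fin N → Space d) × (Fin N → Space d)

variable {d N : ℕ}

/-- The domain `D_N`: the `N` spheres of diameter `ε` do not touch or overlap. -/
def domain (d N : ℕ) (ε : ℝ) : Set (Phase d N) :=
  {Z | ∀ i j, i ≠ j → ε < ‖Z.1 i - Z.1 j‖}

/-- The two distinct particles `i` and `j` touch. -/
def Contact (ε : ℝ) (x : Fin N → Space d) (i j : Fin N) : Prop :=
  i ≠ j ∧ ‖x i - x j‖ = ε

/-- The unit vector `ν^{i,j} = (x_i - x_j) / |x_i - x_j|`. -/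
def normalDir (x : Fin N → Space d) (i j : Fin N) : Space d :=
  ‖x i - x j‖⁻¹ • (x i - x j)

/-- `w` are the velocities just after, when `v` are the velocities just before, the system is at
the positions `x`: particles in contact undergo elastic reflection, and the velocity of a
particle that touches no other one does not change. -/
def Reflects (ε : ℝ) (x v w : Fin N → Space d) : Prop :=
  (∀ i j, Contact ε x i j →
    w i = v i - inner ℝ (normalDir x i j) (v i - v j) • normalDir x i j ∧
    w j = v j + inner ℝ (normalDir x i j) (v i - v j) • normalDir x i j) ∧
  (∀ i, (∀ j, ¬ Contact ε x i j) → w i = v i)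

/-- Some collision at the positions `x` involves more than two particles. -/
def MultipleCollision (ε : ℝ) (x : Fin N → Space d) : Prop :=
  ∃ i j k, j ≠ k ∧ Contact ε x i j ∧ Contact ε x i k

/-- Some collision at the positions `x`, with velocities `v` just before it, is grazing. -/
def GrazingCollision (ε : ℝ) (x v : Fin N → Space d) : Prop :=
  ∃ i j, Contact ε x i j ∧ inner ℝ (normalDir x i j) (v i - v j) = 0

/-- The collision times of the motion `x` in the time interval `[0, T]`. -/
def collisionTimes (ε T : ℝ) (x : ℝ → Fin N → Space d) : Set ℝ :=
  {t | t ∈ Icc 0 T ∧ ∃ i j, Contact ε (x t) i j}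

/-- The motion `(x, v)` is pathological on `[0, T]`: it has a collision of more than two particles,
or a grazing collision, or infinitely many collision times, in `[0, T]`. -/
def Pathological (ε T : ℝ) (x v : ℝ → Fin N → Space d) : Prop :=
  (∃ t ∈ Icc 0 T, MultipleCollision ε (x t)) ∨
  (∃ t ∈ Icc 0 T, GrazingCollision ε (x t) (v t)) ∨
  (collisionTimes ε T x).Infinite

/-- `(x, v)` is a trajectory of the hard-sphere system on `[0, T]` that starts at `Z`. Here `v t`
stands for the velocities just before time `t` (so `v` is left-continuous at collision times, and
the velocities just after a collision are those of `Reflects`). The dynamics cannot be continued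
beyond a pathological event, so such an event may occur at the final time `T` only. -/
structure IsTrajectory (ε T : ℝ) (Z : Phase d N) (x v : ℝ → Fin N → Space d) : Prop where
  /-- initial positions -/
  init_pos : x 0 = Z.1
  /-- initial velocities -/
  init_vel : v 0 = Z.2
  /-- positions are continuous in time -/
  cont : ContinuousOn x (Icc 0 T)
  /-- the spheres never overlap -/
  exclusion : ∀ t ∈ Icc 0 T, ∀ i j, i ≠ j → ε ≤ ‖x t i - x t j‖
  /-- reflection at time `s` (if there is a collision), then free flow as long as no collision
  occurs -/
  free_flow : ∀ s t, 0 ≤ s → s < t → t ≤ T →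
    (∀ τ ∈ Ioo s t, ∀ i j, ¬ Contact ε (x τ) i j) →
    ∃ w, Reflects ε (x s) (v s) w ∧
      ∀ τ ∈ Ioc s t, v τ = w ∧ ∀ i, x τ i = x s i + (τ - s) • w i
  /-- no pathological event before the final time -/
  regular : ∀ T' < T, ¬ Pathological ε T' x v

/-- The initial configuration `Z` leads (forward in time) to a pathological trajectory. -/
def LeadsToPathological (ε : ℝ) (Z : Phase d N) : Prop :=
  ∃ T, 0 ≤ T ∧ ∃ x v, IsTrajectory ε T Z x v ∧ Pathological ε T x v

/-- The trajectory of `Z` is defined for all times `t ≥ 0`, and is unique. -/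
def GloballyDefined (ε : ℝ) (Z : Phase d N) : Prop :=
  ∃ x v : ℝ → Fin N → Space d, (∀ T, 0 ≤ T → IsTrajectory ε T Z x v) ∧
    ∀ T, 0 ≤ T → ∀ x' v', IsTrajectory ε T Z x' v' →
      ∀ t ∈ Icc 0 T, x' t = x t ∧ v' t = v t

/-- Reversal of all velocities: the trajectory of `reverse Z` is the trajectory of `Z` backward
in time. -/
def reverse (Z : Phase d N) : Phase d N := (Z.1, -Z.2)

end HardSphere

end

noncomputable section

namespace HardSphere

variable {d N : ℕ}

/-- The positions at time `t` of the free flow that is at `Z` at time `0`. -/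
def freePos (Z : Phase d N) (t : ℝ) : Fin N → Space d := Z.1 + t • Z.2

/-- The configuration with entries `y` at `i` and `-y` at `j`. -/
def dipole (i j : Fin N) (y : Space d) : Fin N → Space d := Pi.single i y - Pi.single j y

/-- The elastic collision of `i` and `j` at time `t`, as a map between free flows: the free flow of
`scatter ε i j t Z` has the same positions at time `t` as that of `Z`, and the reflected
velocities. -/
def scatter (ε : ℝ) (i j : Fin N) (t : ℝ) (Z : Phase d N) : Phase d N :=
  (Z.1 + t • dipole i j (inner ℝ (ε⁻¹ • (freePos Z t i - freePos Z t j)) (Z.2 i - Z.2 j) •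
      (ε⁻¹ • (freePos Z t i - freePos Z t j))),
    Z.2 - dipole i j (inner ℝ (ε⁻¹ • (freePos Z t i - freePos Z t j)) (Z.2 i - Z.2 j) •
      (ε⁻¹ • (freePos Z t i - freePos Z t j))))

/-- The discriminant of the equation `‖w + t • u‖ = ε` in `t`. -/
def discr (ε : ℝ) (w u : Space d) : ℝ := inner ℝ w u ^ 2 - ‖u‖ ^ 2 * (‖w‖ ^ 2 - ε ^ 2)

/-- The two roots (for `σ = 1` and `σ = -1`) of the equation `‖w + t • u‖ = ε` in `t`. -/
def rootTime (ε σ : ℝ) (w u : Space d) : ℝ := (-inner ℝ w u + σ * √(discr ε w u)) / ‖u‖ ^ 2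

/-- The inverse of the collision map, which uses the time when the free flow leaves contact. -/
def unscatter (ε : ℝ) (i j : Fin N) (Z : Phase d N) : Phase d N :=
  scatter ε i j (rootTime ε 1 (Z.1 i - Z.1 j) (Z.2 i - Z.2 j)) Z

theorem freePos_apply (Z : Phase d N) (t : ℝ) (i : Fin N) : freePos Z t i = Z.1 i + t • Z.2 i :=
  rfl

theorem freePos_sub (Z : Phase d N) (t : ℝ) (i j : Fin N) :
    freePos Z t i - freePos Z t j = (Z.1 i - Z.1 j) + t • (Z.2 i - Z.2 j) := by
  simp only [freePos_apply]; module

theorem freePos_add (Z : Phase d N) (t s : ℝ) (i : Fin N) :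
    freePos Z (t + s) i = freePos Z t i + s • Z.2 i := by
  simp only [freePos_apply]; module

theorem freePos_scatter (ε : ℝ) (i j : Fin N) (t : ℝ) (Z : Phase d N) :
    freePos (scatter ε i j t Z) t = freePos Z t := by
  simp only [freePos, scatter]; module

theorem norm_add_smul_sq (w u : Space d) (t : ℝ) :
    ‖w + t • u‖ ^ 2 = ‖w‖ ^ 2 + 2 * t * inner ℝ w u + t ^ 2 * ‖u‖ ^ 2 := by
  rw [norm_add_sq_real, inner_smul_right, norm_smul, mul_pow, Real.norm_eq_abs, sq_abs]; ring

theorem inner_add_smul (w u : Space d) (t : ℝ) :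
    inner ℝ (w + t • u) u = inner ℝ w u + t * ‖u‖ ^ 2 := by
  rw [inner_add_left, real_inner_smul_left, real_inner_self_eq_norm_sq]

theorem discr_eq_of_norm_eq {ε t : ℝ} {w u : Space d} (h : ‖w + t • u‖ = ε) :
    discr ε w u = inner ℝ (w + t • u) u ^ 2 := by
  have := norm_add_smul_sq w u t
  rw [inner_add_smul, discr, ← h, this]; ring

theorem eq_rootTime_of_norm_eq {ε σ t : ℝ} {w u : Space d} (h : ‖w + t • u‖ = ε) (hu : u ≠ 0)
    (hσ : σ * |inner ℝ (w + t • u) u| = inner ℝ (w + t • u) u) :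
    t = rootTime ε σ w u := by
  rw [rootTime, discr_eq_of_norm_eq h, Real.sqrt_sq_eq_abs, hσ, inner_add_smul]
  have : ‖u‖ ≠ 0 := by simpa using hu
  field_simp; ring

theorem dipole_left {i j : Fin N} (h : i ≠ j) (y : Space d) : dipole i j y i = y := by
  simp [dipole, h]

theorem dipole_right {i j : Fin N} (h : i ≠ j) (y : Space d) : dipole i j y j = -y := by
  simp [dipole, h.symm]

theorem dipole_of_ne {i j k : Fin N} (hi : k ≠ i) (hj : k ≠ j) (y : Space d) :
    dipole i j y k = 0 := by
  simp [dipole, hi, hj]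

theorem sum_inner_dipole (i j : Fin N) (p : Fin N → Space d) (y : Space d) :
    ∑ k, inner ℝ (p k) (dipole i j y k) = inner ℝ (p i - p j) y := by
  have h : ∀ l, ∑ k, inner ℝ (p k) ((Pi.single l y : Fin N → Space d) k) = inner ℝ (p l) y := by
    intro l
    rw [Finset.sum_eq_single_of_mem l (Finset.mem_univ l) fun k _ hk => by simp [hk]]
    simp
  simp only [dipole, Pi.sub_apply, inner_sub_right, Finset.sum_sub_distrib, inner_sub_left, h]

/-- The change of relative velocity in a collision along the unit vector `n`. -/
theorem scatter_vel_sub {ε t : ℝ} {i j : Fin N} (h : i ≠ j) (Z : Phase d N) :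
    (scatter ε i j t Z).2 i - (scatter ε i j t Z).2 j = (Z.2 i - Z.2 j) -
      (2 * inner ℝ (ε⁻¹ • (freePos Z t i - freePos Z t j)) (Z.2 i - Z.2 j)) •
        (ε⁻¹ • (freePos Z t i - freePos Z t j)) := by
  simp only [scatter, Pi.sub_apply, dipole_left h, dipole_right h]; module

theorem norm_inv_smul_contact {ε : ℝ} (hε : 0 < ε) {w : Space d} (hw : ‖w‖ = ε) :
    ‖ε⁻¹ • w‖ = 1 := by
  rw [norm_smul, hw, norm_inv, Real.norm_of_nonneg hε.le, inv_mul_cancel₀ hε.ne']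

theorem inner_scatter_vel_sub {ε t : ℝ} (hε : 0 < ε) {i j : Fin N} {Z : Phase d N}
    (h : Contact ε (freePos Z t) i j) :
    inner ℝ (ε⁻¹ • (freePos Z t i - freePos Z t j))
        ((scatter ε i j t Z).2 i - (scatter ε i j t Z).2 j) =
      -inner ℝ (ε⁻¹ • (freePos Z t i - freePos Z t j)) (Z.2 i - Z.2 j) := by
  rw [scatter_vel_sub h.1, inner_sub_right, inner_smul_right, real_inner_self_eq_norm_sq,
    norm_inv_smul_contact hε h.2]
  ring

theorem scatter_scatter {ε t : ℝ} (hε : 0 < ε) {i j : Fin N} {Z : Phase d N}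
    (h : Contact ε (freePos Z t) i j) : scatter ε i j t (scatter ε i j t Z) = Z := by
  have h1 := inner_scatter_vel_sub hε h
  have h2 := freePos_scatter ε i j t Z
  generalize hZ : scatter ε i j t Z = Z' at *
  rw [scatter, h2, h1]
  subst hZ
  have hd : ∀ y : Space d, dipole i j (-y) = -dipole i j y := fun y => by
    simp [dipole, Pi.single_neg, sub_eq_add_neg, add_comm]
  simp only [scatter, neg_smul, hd]
  ext1 <;> simp

/-- The free flow `Z` has, at time `t`, the incoming contact `{i, j}` and no other contact. -/
structure Collides (ε : ℝ) (i j : Fin N) (t : ℝ) (Z : Phase d N) : Prop where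
  contact : Contact ε (freePos Z t) i j
  incoming : inner ℝ (freePos Z t i - freePos Z t j) (Z.2 i - Z.2 j) < 0
  others : ∀ k l, k ≠ l → (k = i ∧ l = j) ∨ (k = j ∧ l = i) ∨ ε < ‖freePos Z t k - freePos Z t l‖

/-- All contacts of the free flow `Z` at time `t` are outgoing. -/
def Outgoing (ε : ℝ) (t : ℝ) (Z : Phase d N) : Prop :=
  ∀ k l, k ≠ l → ε < ‖freePos Z t k - freePos Z t l‖ ∨
    (‖freePos Z t k - freePos Z t l‖ = ε ∧
      0 < inner ℝ (freePos Z t k - freePos Z t l) (Z.2 k - Z.2 l))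

theorem Collides.contact_iff {ε t : ℝ} {i j : Fin N} {Z : Phase d N} (h : Collides ε i j t Z)
    {k l : Fin N} (hkl : Contact ε (freePos Z t) k l) : (k = i ∧ l = j) ∨ (k = j ∧ l = i) := by
  rcases h.others k l hkl.1 with h | h | h
  · exact .inl h
  · exact .inr h
  · exact absurd hkl.2 h.ne'

theorem Collides.le {ε t : ℝ} {i j : Fin N} {Z : Phase d N} (h : Collides ε i j t Z)
    {k l : Fin N} (hkl : k ≠ l) : ε ≤ ‖freePos Z t k - freePos Z t l‖ := by
  rcases h.others k l hkl with ⟨rfl, rfl⟩ | ⟨rfl, rfl⟩ | h'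
  · exact h.contact.2.ge
  · rw [norm_sub_rev]; exact h.contact.2.ge
  · exact h'.le

theorem Collides.outgoing {ε t : ℝ} (hε : 0 < ε) {i j : Fin N} {Z : Phase d N}
    (h : Collides ε i j t Z) : Outgoing ε t (scatter ε i j t Z) := by
  have key : 0 < inner ℝ (freePos Z t i - freePos Z t j)
      ((scatter ε i j t Z).2 i - (scatter ε i j t Z).2 j) := by
    have := inner_scatter_vel_sub hε h.contact
    rw [real_inner_smul_left, real_inner_smul_left, ← mul_neg] at this
    rw [mul_left_cancel₀ (inv_ne_zero hε.ne') this]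
    linarith [h.incoming]
  intro k l hkl
  rw [freePos_scatter]
  rcases h.others k l hkl with ⟨rfl, rfl⟩ | ⟨rfl, rfl⟩ | h'
  · exact .inr ⟨h.contact.2, key⟩
  · refine .inr ⟨by rw [norm_sub_rev]; exact h.contact.2, ?_⟩
    rw [← neg_sub (freePos Z t l), ← neg_sub ((scatter ε l k t Z).2 l), inner_neg_neg]
    exact key
  · exact .inl h'

theorem normalDir_of_contact {ε : ℝ} {x : Fin N → Space d} {i j : Fin N} (h : Contact ε x i j) :
    normalDir x i j = ε⁻¹ • (x i - x j) := by
  rw [normalDir, h.2]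

theorem Collides.reflects {ε t : ℝ} {i j : Fin N} {Z : Phase d N} (h : Collides ε i j t Z) :
    Reflects ε (freePos Z t) Z.2 (scatter ε i j t Z).2 := by
  have hij := h.contact.1
  constructor
  · intro k l hkl
    rw [normalDir_of_contact hkl]
    rcases h.contact_iff hkl with ⟨rfl, rfl⟩ | ⟨rfl, rfl⟩
    · constructor <;> simp only [scatter, Pi.sub_apply, dipole_left hij, dipole_right hij]
      module
    · have e : inner ℝ (ε⁻¹ • (freePos Z t k - freePos Z t l)) (Z.2 k - Z.2 l) =
          inner ℝ (ε⁻¹ • (freePos Z t l - freePos Z t k)) (Z.2 l - Z.2 k) := by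
        rw [← neg_sub (freePos Z t l), ← neg_sub (Z.2 l), smul_neg, inner_neg_neg]
      rw [e]
      constructor <;> simp only [scatter, Pi.sub_apply, dipole_left hij, dipole_right hij] <;>
      module
  · intro k hk
    have hi : k ≠ i := by rintro rfl; exact hk _ h.contact
    have hj : k ≠ j := by
      rintro rfl; exact hk i ⟨hij.symm, by rw [norm_sub_rev]; exact h.contact.2⟩
    simp [scatter, dipole_of_ne hi hj]

theorem Collides.vel_ne {ε t : ℝ} (hε : 0 < ε) {i j : Fin N} {Z : Phase d N}
    (h : Collides ε i j t Z) : (scatter ε i j t Z).2 ≠ Z.2 := by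
  intro e
  have h1 := inner_scatter_vel_sub hε h.contact
  rw [e, real_inner_smul_left] at h1
  have : ε⁻¹ * inner ℝ (freePos Z t i - freePos Z t j) (Z.2 i - Z.2 j) < 0 :=
    mul_neg_of_pos_of_neg (inv_pos.2 hε) h.incoming
  linarith

theorem Collides.sum_norm_sq {ε t : ℝ} (hε : 0 < ε) {i j : Fin N} {Z : Phase d N}
    (h : Collides ε i j t Z) :
    ∑ k, ‖(scatter ε i j t Z).2 k‖ ^ 2 = ∑ k, ‖Z.2 k‖ ^ 2 := by
  have hij := h.contact.1
  set n := ε⁻¹ • (freePos Z t i - freePos Z t j) with hn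
  have hn1 : ‖n‖ = 1 := norm_inv_smul_contact hε h.contact.2
  set a := inner ℝ n (Z.2 i - Z.2 j) with ha
  have e : ∀ k, ‖(scatter ε i j t Z).2 k‖ ^ 2 = ‖Z.2 k‖ ^ 2 -
      2 * inner ℝ (Z.2 k) (dipole i j (a • n) k) +
      inner ℝ (dipole i j (a • n) k) (dipole i j (a • n) k) := fun k => by
    rw [real_inner_self_eq_norm_sq]
    exact norm_sub_sq_real _ _
  simp only [e, Finset.sum_add_distrib, Finset.sum_sub_distrib, ← Finset.mul_sum,
    sum_inner_dipole, dipole_left hij, dipole_right hij]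
  rw [inner_smul_right, real_inner_comm, ← ha, sub_neg_eq_add, inner_add_left,
    real_inner_self_eq_norm_sq, norm_smul, hn1, mul_one, Real.norm_eq_abs, sq_abs]
  ring

/-- Convexity of the obstacle: the impulse of a collision points away from any configuration in
which the two particles touch or overlap. -/
theorem Collides.sum_inner_nonneg {ε t : ℝ} (hε : 0 < ε) {i j : Fin N} {Z : Phase d N}
    (h : Collides ε i j t Z) {x : Fin N → Space d} (hx : ‖x i - x j‖ ≤ ε) :
    0 ≤ ∑ k, inner ℝ (freePos Z t k - x k) ((scatter ε i j t Z).2 k - Z.2 k) := by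
  set n := ε⁻¹ • (freePos Z t i - freePos Z t j) with hn
  have hn1 : ‖n‖ = 1 := norm_inv_smul_contact hε h.contact.2
  have e : ∀ k, inner ℝ (freePos Z t k - x k) ((scatter ε i j t Z).2 k - Z.2 k) =
      -inner ℝ ((freePos Z t - x) k) (dipole i j (inner ℝ n (Z.2 i - Z.2 j) • n) k) := fun k => by
    rw [← inner_neg_right]
    simp [scatter, hn]
  have hw : freePos Z t i - freePos Z t j = ε • n := by rw [hn, smul_inv_smul₀ hε.ne']
  have ha : inner ℝ n (Z.2 i - Z.2 j) ≤ 0 := by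
    rw [hn, real_inner_smul_left]
    exact mul_nonpos_of_nonneg_of_nonpos (inv_nonneg.2 hε.le) h.incoming.le
  have hx' : inner ℝ (x i - x j) n ≤ ε := by
    refine (real_inner_le_norm _ _).trans ?_
    rwa [hn1, mul_one]
  have e2 : (freePos Z t - x) i - (freePos Z t - x) j = ε • n - (x i - x j) := by
    rw [← hw]; simp only [Pi.sub_apply]; abel
  simp only [e, Finset.sum_neg_distrib, sum_inner_dipole]
  rw [e2, inner_smul_right, inner_sub_left, real_inner_smul_left n n, real_inner_self_eq_norm_sq,
    hn1]
  nlinarith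

theorem Collides.discr_pos {ε t : ℝ} (hε : 0 < ε) {i j : Fin N} {Z : Phase d N}
    (h : Collides ε i j t Z) :
    0 < discr ε ((scatter ε i j t Z).1 i - (scatter ε i j t Z).1 j)
      ((scatter ε i j t Z).2 i - (scatter ε i j t Z).2 j) := by
  rcases h.outgoing hε i j h.contact.1 with h' | ⟨h1, h2⟩
  · rw [freePos_scatter, h.contact.2] at h'; exact absurd h' (lt_irrefl _)
  · rw [freePos_sub] at h1 h2
    rw [discr_eq_of_norm_eq h1]
    positivity

theorem Collides.unscatter_scatter {ε t : ℝ} (hε : 0 < ε) {i j : Fin N} {Z : Phase d N}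
    (h : Collides ε i j t Z) : unscatter ε i j (scatter ε i j t Z) = Z := by
  rcases h.outgoing hε i j h.contact.1 with h' | ⟨h1, h2⟩
  · rw [freePos_scatter, h.contact.2] at h'; exact absurd h' (lt_irrefl _)
  · rw [freePos_sub] at h1 h2
    have hu : (scatter ε i j t Z).2 i - (scatter ε i j t Z).2 j ≠ 0 := by
      intro h0; rw [h0, inner_zero_right] at h2; exact lt_irrefl _ h2
    rw [unscatter, ← eq_rootTime_of_norm_eq h1 hu (by rw [one_mul, abs_of_pos h2]),
      scatter_scatter hε h.contact]

open Filter Topology in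
/-- Collisions with convex obstacles do not accumulate: a path of constant speed that consists of
straight pieces, and whose velocity jumps point away from the limit position, has no jump near its
final time. -/
theorem eventually_velocity_eq {H : Type*} [NormedAddCommGroup H] [InnerProductSpace ℝ H]
    {p V : ℕ → H} {t : ℕ → ℝ} {c T : ℝ} {q : H} (ht : StrictMono t)
    (htT : Tendsto t atTop (𝓝 T)) (hp : ∀ n, p (n + 1) = p n + (t (n + 1) - t n) • V n)
    (hV : ∀ n, ‖V n‖ = c) (hpq : Tendsto p atTop (𝓝 q))
    (hjump : ∀ᶠ n in atTop, 0 ≤ inner ℝ (p (n + 1) - q) (V (n + 1) - V n)) :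
    ∀ᶠ n in atTop, V (n + 1) = V n := by
  obtain ⟨n₀, hn₀⟩ := eventually_atTop.1 hjump
  have hlt : ∀ n, t n < T := fun n =>
    (ht (Nat.lt_succ_self n)).trans_le (ht.monotone.ge_of_tendsto htT _)
  have hy0 : Tendsto (fun n => p n - q) atTop (𝓝 0) := by
    simpa using hpq.sub_const q
  have hn : ∀ n, ‖p n - q‖ ≤ c * (T - t n) := by
    intro n
    have h1 : ∀ m, n ≤ m → ‖p n - q‖ ≤ c * (t m - t n) + ‖p m - q‖ := by
      intro m hm
      induction m, hm using Nat.le_induction with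
      | base => simp
      | succ m hm ih =>
        have h2 : p m - q = (p (m + 1) - q) - (t (m + 1) - t m) • V m := by rw [hp]; abel
        have h3 := norm_sub_le (p (m + 1) - q) ((t (m + 1) - t m) • V m)
        rw [← h2, norm_smul, hV, Real.norm_of_nonneg (sub_nonneg.2 (ht.monotone m.le_succ))] at h3
        linarith
    have h2 : Tendsto (fun m => c * (t m - t n) + ‖p m - q‖) atTop (𝓝 (c * (T - t n) + 0)) := by
      refine Tendsto.add ((htT.sub_const _).const_mul _) ?_
      simpa using hy0.norm
    rw [add_zero] at h2
    exact ge_of_tendsto h2 (eventually_atTop.2 ⟨n, h1⟩)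
  have hi : ∀ n, n₀ ≤ n → inner ℝ (p n - q) (V n) ≤ -(c ^ 2 * (T - t n)) := by
    intro n hnn
    have h1 : ∀ m, n ≤ m →
        inner ℝ (p n - q) (V n) + c ^ 2 * (t m - t n) ≤ inner ℝ (p m - q) (V m) := by
      intro m hm
      induction m, hm using Nat.le_induction with
      | base => simp
      | succ m hm ih =>
        have h2 := hn₀ m (hnn.trans hm)
        have h3 : inner ℝ (p (m + 1) - q) (V m) =
            inner ℝ (p m - q) (V m) + (t (m + 1) - t m) * c ^ 2 := by
          rw [hp, ← hV m, ← real_inner_self_eq_norm_sq, ← real_inner_smul_left, ← inner_add_left]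
          congr 1; abel
        rw [inner_sub_right] at h2
        linarith
    have h2 : Tendsto (fun m => inner ℝ (p m - q) (V m)) atTop (𝓝 0) := by
      refine squeeze_zero_norm (a := fun m => ‖p m - q‖ * c) (fun m => ?_) ?_
      · rw [← hV m]; exact norm_inner_le_norm _ _
      · simpa using hy0.norm.mul_const c
    have h3 : Tendsto (fun m => inner ℝ (p n - q) (V n) + c ^ 2 * (t m - t n)) atTop
        (𝓝 (inner ℝ (p n - q) (V n) + c ^ 2 * (T - t n))) :=
      ((htT.sub_const _).const_mul _).const_add _
    have := le_of_tendsto_of_tendsto h3 h2 (eventually_atTop.2 ⟨n, h1⟩)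
    linarith
  have hstraight : ∀ n, n₀ ≤ n → p n - q = -((T - t n) • V n) := by
    intro n hnn
    have h1 : ‖(p n - q) + (T - t n) • V n‖ ^ 2 ≤ 0 := by
      rw [norm_add_sq_real, inner_smul_right, norm_smul, hV, Real.norm_of_nonneg
        (sub_nonneg.2 (hlt n).le)]
      have h2 := pow_le_pow_left₀ (norm_nonneg _) (hn n) 2
      have h3 := mul_le_mul_of_nonneg_left (hi n hnn) (sub_nonneg.2 (hlt n).le)
      nlinarith
    have h2 : (p n - q) + (T - t n) • V n = 0 := by
      have := pow_eq_zero_iff (two_ne_zero) |>.1 (le_antisymm h1 (sq_nonneg _))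
      simpa using this
    exact eq_neg_of_add_eq_zero_left h2
  refine eventually_atTop.2 ⟨n₀, fun n hnn => ?_⟩
  have h1 := hstraight n hnn
  have h2 := hstraight (n + 1) (hnn.trans n.le_succ)
  have h3 : (T - t (n + 1)) • V (n + 1) = (T - t (n + 1)) • V n := by
    have h4 : p (n + 1) - q = (p n - q) + (t (n + 1) - t n) • V n := by rw [hp]; abel
    rw [h2, h1] at h4
    rw [← neg_inj, h4]; module
  exact smul_right_injective H (sub_pos.2 (hlt (n + 1))).ne' h3

instance : (volume : Measure (Phase d N)).IsAddHaarMeasure :=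
  Measure.prod.instIsAddHaarMeasure _ _

/-- A measurable set of configurations is null if all its slices in the position of one particle
are null. -/
theorem volume_eq_zero_of_slices (k : Fin N) {A : Set (Phase d N)} (hA : MeasurableSet A)
    (h : ∀ Z : Phase d N, volume {y : Space d | (Z.1 + Pi.single k y, Z.2) ∈ A} = 0) :
    volume A = 0 := by
  have := ae_mem_of_ae_add_linearMap_mem
    ((LinearMap.inl ℝ (Fin N → Space d) (Fin N → Space d)) ∘ₗ LinearMap.single ℝ (fun _ => Space d) k)
    volume volume hA.compl (fun Z => by
      rw [ae_iff]
      convert h Z using 3 with y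
      simp only [mem_compl_iff, not_not, LinearMap.comp_apply, LinearMap.inl_apply,
        LinearMap.single_apply]
      funext y
      exact congrArg (· ∈ A) (by ext1 <;> simp))
  simpa [ae_iff] using this

theorem measurable_rootTime (ε σ : ℝ) (i j : Fin N) :
    Measurable fun Z : Phase d N => rootTime ε σ (Z.1 i - Z.1 j) (Z.2 i - Z.2 j) := by
  unfold rootTime discr
  fun_prop

theorem volume_rootTime_contact {ε : ℝ} (hε : 0 < ε) (σ : ℝ) {i j k l : Fin N} (hki : k ≠ i)
    (hkj : k ≠ j) (hkl : k ≠ l) :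
    volume {Z : Phase d N | ‖(Z.1 k - Z.1 l) +
      rootTime ε σ (Z.1 i - Z.1 j) (Z.2 i - Z.2 j) • (Z.2 k - Z.2 l)‖ = ε} = 0 := by
  refine volume_eq_zero_of_slices k (measurableSet_eq_fun ?_ measurable_const) fun Z => ?_
  · have := measurable_rootTime (d := d) ε σ i j
    fun_prop
  · set τ := rootTime ε σ (Z.1 i - Z.1 j) (Z.2 i - Z.2 j) with hτ
    convert Measure.addHaar_sphere_of_ne_zero volume
      (-(Z.1 k - Z.1 l + τ • (Z.2 k - Z.2 l))) hε.ne' using 2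
    ext y
    simp only [mem_ofPred_eq, mem_sphere_iff_norm, Pi.add_apply, Pi.single_eq_same,
      Pi.single_eq_of_ne hki.symm, Pi.single_eq_of_ne hkj.symm, Pi.single_eq_of_ne hkl.symm,
      add_zero, ← hτ]
    rw [show Z.1 k + y - Z.1 l + τ • (Z.2 k - Z.2 l) =
      y - -(Z.1 k - Z.1 l + τ • (Z.2 k - Z.2 l)) by abel]

/-- The level sets of the norm of a linear map are null. -/
theorem volume_norm_linearMap_eq {E F : Type*} [NormedAddCommGroup E] [NormedSpace ℝ E]
    [FiniteDimensional ℝ E] [MeasurableSpace E] [BorelSpace E] (μ : Measure E) [μ.IsAddHaarMeasure]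
    [NormedAddCommGroup F] [NormedSpace ℝ F] (P : E →ₗ[ℝ] F) {r : ℝ} (hr : 0 < r) :
    μ {y | ‖P y‖ = r} = 0 := by
  have hc : Convex ℝ (P ⁻¹' Metric.closedBall 0 r) :=
    (convex_closedBall (0 : F) r).linear_preimage P
  refine measure_mono_null (fun y hy => ?_) (hc.addHaar_frontier μ)
  refine ⟨subset_closure ?_, fun hi => ?_⟩
  · simpa using (show ‖P y‖ = r from hy).le
  · have h1 : ∀ᶠ s : ℝ in nhds 1, s • y ∈ interior (P ⁻¹' Metric.closedBall 0 r) := by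
      have : ContinuousAt (fun s : ℝ => s • y) 1 := by fun_prop
      exact this.eventually (by simpa using isOpen_interior.mem_nhds hi)
    obtain ⟨s, hs, hs1⟩ := ((h1.filter_mono nhdsWithin_le_nhds).and
      (self_mem_nhdsWithin : Ioi (1 : ℝ) ∈ nhdsWithin 1 (Ioi 1))).exists
    have h2 := interior_subset hs
    have hs1 : 1 < s := hs1
    have hy : ‖P y‖ = r := hy
    simp only [mem_preimage, map_smul, mem_closedBall_zero_iff, norm_smul, hy, Real.norm_eq_abs,
      abs_of_pos (zero_lt_one.trans hs1)] at h2
    nlinarith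

theorem volume_grazing {ε : ℝ} (hε : 0 < ε) {i j : Fin N} (hij : i ≠ j) :
    volume {Z : Phase d N | ∃ t, ‖freePos Z t i - freePos Z t j‖ = ε ∧
      inner ℝ (freePos Z t i - freePos Z t j) (Z.2 i - Z.2 j) = 0} = 0 := by
  have key : volume {Z : Phase d N | ‖(Z.1 i - Z.1 j) -
      (inner ℝ (Z.1 i - Z.1 j) (Z.2 i - Z.2 j) / ‖Z.2 i - Z.2 j‖ ^ 2) • (Z.2 i - Z.2 j)‖ = ε}
      = 0 := by
    refine volume_eq_zero_of_slices i (measurableSet_eq_fun (by fun_prop) measurable_const)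
      fun Z => ?_
    set u := Z.2 i - Z.2 j with hu
    let P : Space d →ₗ[ℝ] Space d :=
      LinearMap.id - ((‖u‖ ^ 2)⁻¹ • (innerₗ (Space d) u)).smulRight u
    have hP : ∀ y, P y = y - (inner ℝ y u / ‖u‖ ^ 2) • u := fun y => by
      simp [P, real_inner_comm, div_eq_inv_mul]
    have h0 := volume_norm_linearMap_eq volume P hε
    rw [← measure_preimage_add volume (Z.1 i - Z.1 j)] at h0
    convert h0 using 2
    ext y
    simp only [mem_ofPred_eq, mem_preimage, hP, Pi.add_apply, Pi.single_eq_same,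
      Pi.single_eq_of_ne hij.symm, add_zero, ← hu]
    rw [show Z.1 i + y - Z.1 j = Z.1 i - Z.1 j + y by abel]
  refine measure_mono_null ?_ key
  rintro Z ⟨t, h1, h2⟩
  rw [freePos_sub] at h1 h2
  rw [inner_add_smul] at h2
  rw [mem_ofPred_eq, ← h1]
  rcases eq_or_ne (Z.2 i - Z.2 j) 0 with hu | hu
  · simp [hu]
  · have : ‖Z.2 i - Z.2 j‖ ≠ 0 := by simpa using hu
    have ht : inner ℝ (Z.1 i - Z.1 j) (Z.2 i - Z.2 j) / ‖Z.2 i - Z.2 j‖ ^ 2 = -t := by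
      field_simp; linarith
    rw [ht, neg_smul, sub_neg_eq_add]

/-- The free flows that have a grazing contact, or contacts of two pairs of particles at the same
time. -/
def exceptional (d N : ℕ) (ε : ℝ) : Set (Phase d N) :=
  {Z | ∃ i j t, Contact ε (freePos Z t) i j ∧
    (inner ℝ (freePos Z t i - freePos Z t j) (Z.2 i - Z.2 j) = 0 ∨
      ∃ k l, Contact ε (freePos Z t) k l ∧ ¬((k = i ∧ l = j) ∨ (k = j ∧ l = i)))}

theorem volume_exceptional {ε : ℝ} (hε : 0 < ε) : volume (exceptional d N ε) = 0 := by
  have h1 : ∀ i j : Fin N, i ≠ j → volume {Z : Phase d N |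
      ∃ t, ‖freePos Z t i - freePos Z t j‖ = ε ∧
        inner ℝ (freePos Z t i - freePos Z t j) (Z.2 i - Z.2 j) = 0} = 0 :=
    fun i j => volume_grazing hε
  have h2 : ∀ σ ∈ ({1, -1} : Set ℝ), ∀ i j k l : Fin N, k ≠ i ∧ k ≠ j ∧ k ≠ l →
      volume {Z : Phase d N | ‖(Z.1 k - Z.1 l) +
        rootTime ε σ (Z.1 i - Z.1 j) (Z.2 i - Z.2 j) • (Z.2 k - Z.2 l)‖ = ε} = 0 :=
    fun σ _ i j k l h => volume_rootTime_contact hε σ h.1 h.2.1 h.2.2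
  have hc : ({1, -1} : Set ℝ).Countable := by simp
  have h1' := ae_all_iff.2 fun i => ae_all_iff.2 fun j => ae_all_iff.2 fun hij : i ≠ j =>
    measure_eq_zero_iff_ae_notMem.1 (h1 i j hij)
  have h2' := (ae_ball_iff hc).2 fun σ hσ => ae_all_iff.2 fun i => ae_all_iff.2 fun j =>
    ae_all_iff.2 fun k => ae_all_iff.2 fun l => ae_all_iff.2 fun h : k ≠ i ∧ k ≠ j ∧ k ≠ l =>
      measure_eq_zero_iff_ae_notMem.1 (h2 σ hσ i j k l h)
  rw [measure_eq_zero_iff_ae_notMem]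
  filter_upwards [h1', h2'] with Z hg hm hZ
  obtain ⟨i, j, t, hij, h⟩ := hZ
  have hng : inner ℝ (freePos Z t i - freePos Z t j) (Z.2 i - Z.2 j) ≠ 0 :=
    fun h0 => hg i j hij.1 ⟨t, hij.2, h0⟩
  obtain ⟨k, l, hkl, hne⟩ := h.resolve_left hng
  have hu : Z.2 i - Z.2 j ≠ 0 := fun h0 => hng (by rw [h0, inner_zero_right])
  obtain ⟨σ, hσ, hσ'⟩ : ∃ σ ∈ ({1, -1} : Set ℝ),
      σ * |inner ℝ (freePos Z t i - freePos Z t j) (Z.2 i - Z.2 j)| =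
        inner ℝ (freePos Z t i - freePos Z t j) (Z.2 i - Z.2 j) := by
    rcases abs_choice (inner ℝ (freePos Z t i - freePos Z t j) (Z.2 i - Z.2 j)) with h | h
    · exact ⟨1, by simp, by rw [h, one_mul]⟩
    · exact ⟨-1, by simp, by rw [h]; ring⟩
  have hij2 := hij.2
  rw [freePos_sub] at hσ' hij2
  have ht := eq_rootTime_of_norm_eq hij2 hu hσ'
  have main : ∀ k l : Fin N, Contact ε (freePos Z t) k l → k ≠ i → k ≠ j → False := by
    intro k l hkl hki hkj
    refine hm σ hσ i j k l ⟨hki, hkj, hkl.1⟩ ?_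
    rw [← ht, ← freePos_sub]
    exact hkl.2
  have hlk : Contact ε (freePos Z t) l k := ⟨hkl.1.symm, by rw [norm_sub_rev]; exact hkl.2⟩
  have := main k l hkl
  have := main l k hlk
  have := hkl.1
  grind

theorem differentiable_dipole (i j : Fin N) :
    Differentiable ℝ (dipole i j : Space d → Fin N → Space d) := by
  rw [differentiable_pi]
  intro k
  have h : ∀ l : Fin N, Differentiable ℝ fun y : Space d => (Pi.single l y : Fin N → Space d) k := by
    intro l
    by_cases hl : k = l
    · subst hl; simp
    · simp [hl]
  exact (h i).sub (h j)

theorem differentiableOn_unscatter (ε : ℝ) (i j : Fin N) :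
    DifferentiableOn ℝ (unscatter ε i j : Phase d N → Phase d N)
      {Z | 0 < discr ε (Z.1 i - Z.1 j) (Z.2 i - Z.2 j)} := by
  intro Z hZ
  have hZ : 0 < discr ε (Z.1 i - Z.1 j) (Z.2 i - Z.2 j) := hZ
  refine DifferentiableAt.differentiableWithinAt ?_
  have hu : ‖Z.2 i - Z.2 j‖ ^ 2 ≠ 0 := by
    intro h
    have h0 : Z.2 i - Z.2 j = 0 := by simpa using h
    simp [discr, h0] at hZ
  have hw : DifferentiableAt ℝ (fun Z : Phase d N => Z.1 i - Z.1 j) Z := by fun_prop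
  have hv : DifferentiableAt ℝ (fun Z : Phase d N => Z.2 i - Z.2 j) Z := by fun_prop
  have hwv := hw.inner ℝ hv
  have hw2 := hw.norm_sq ℝ
  have hv2 := hv.norm_sq ℝ
  have hd : DifferentiableAt ℝ
      (fun Z : Phase d N => discr ε (Z.1 i - Z.1 j) (Z.2 i - Z.2 j)) Z := by
    unfold discr
    fun_prop
  have hs := hd.sqrt hZ.ne'
  have hτ : DifferentiableAt ℝ
      (fun Z : Phase d N => rootTime ε 1 (Z.1 i - Z.1 j) (Z.2 i - Z.2 j)) Z := by
    unfold rootTime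
    have hi := hv2.fun_inv hu
    simp only [div_eq_mul_inv]
    fun_prop
  have hn : DifferentiableAt ℝ (fun Z : Phase d N =>
      ε⁻¹ • (freePos Z (rootTime ε 1 (Z.1 i - Z.1 j) (Z.2 i - Z.2 j)) i -
        freePos Z (rootTime ε 1 (Z.1 i - Z.1 j) (Z.2 i - Z.2 j)) j)) Z := by
    simp only [freePos_apply]
    fun_prop
  have hJ := (differentiable_dipole i j _).comp Z ((hn.inner ℝ hv).smul hn)
  exact (differentiableAt_fst.add (hτ.smul hJ)).prodMk (differentiableAt_snd.sub hJ)

/-- The free flows that lead to an exceptional one through at most `n` collisions. -/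
def exceptionalIter (d N : ℕ) (ε : ℝ) : ℕ → Set (Phase d N)
  | 0 => exceptional d N ε
  | n + 1 => ⋃ (i : Fin N) (j : Fin N), unscatter ε i j ''
      (exceptionalIter d N ε n ∩ {Z | 0 < discr ε (Z.1 i - Z.1 j) (Z.2 i - Z.2 j)})

theorem volume_exceptionalIter {ε : ℝ} (hε : 0 < ε) (n : ℕ) :
    volume (exceptionalIter d N ε n) = 0 := by
  induction n with
  | zero => exact volume_exceptional hε
  | succ n ih =>
    refine measure_iUnion_null fun i => measure_iUnion_null fun j => ?_
    exact addHaar_image_eq_zero_of_differentiableOn_of_addHaar_eq_zero volume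
      ((differentiableOn_unscatter ε i j).mono inter_subset_right)
      (measure_mono_null inter_subset_left ih)

/-- A free flow is regular if no sequence of collisions leads it to an exceptional one. -/
def Regular (ε : ℝ) (Z : Phase d N) : Prop := ∀ n, Z ∉ exceptionalIter d N ε n

theorem ae_regular {ε : ℝ} (hε : 0 < ε) : ∀ᵐ Z : Phase d N, Regular ε Z :=
  ae_all_iff.2 fun n => measure_eq_zero_iff_ae_notMem.1 (volume_exceptionalIter hε n)

theorem Regular.scatter {ε t : ℝ} (hε : 0 < ε) {i j : Fin N} {Z : Phase d N} (hZ : Regular ε Z)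
    (h : Collides ε i j t Z) : Regular ε (scatter ε i j t Z) := by
  intro n hn
  refine hZ (n + 1) (mem_iUnion₂.2 ⟨i, j, _, ⟨hn, h.discr_pos hε⟩, h.unscatter_scatter hε⟩)

theorem Regular.inner_ne_zero {ε t : ℝ} {i j : Fin N} {Z : Phase d N} (hZ : Regular ε Z)
    (h : Contact ε (freePos Z t) i j) :
    inner ℝ (freePos Z t i - freePos Z t j) (Z.2 i - Z.2 j) ≠ 0 :=
  fun h0 => hZ 0 ⟨i, j, t, h, .inl h0⟩

theorem Regular.contact_unique {ε t : ℝ} {i j k l : Fin N} {Z : Phase d N} (hZ : Regular ε Z)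
    (h : Contact ε (freePos Z t) i j) (h' : Contact ε (freePos Z t) k l) :
    (k = i ∧ l = j) ∨ (k = j ∧ l = i) := by
  by_contra hne
  exact hZ 0 ⟨i, j, t, h, .inr ⟨k, l, h', hne⟩⟩

/-- No two particles of the free flow `Z` touch or overlap at time `t`. -/
def Clear (ε t : ℝ) (Z : Phase d N) : Prop :=
  ∀ k l, k ≠ l → ε < ‖freePos Z t k - freePos Z t l‖

theorem Clear.not_contact {ε t : ℝ} {Z : Phase d N} (h : Clear ε t Z) (i j : Fin N) :
    ¬Contact ε (freePos Z t) i j :=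
  fun hc => (h i j hc.1).ne' hc.2

/-- The free flow `Z` proceeds without contact from time `t` to time `t'`, when either a collision
turns it into `Z'`, or there is no contact and `t' = t + 1`. -/
structure Step (ε : ℝ) (Z : Phase d N) (t : ℝ) (Z' : Phase d N) (t' : ℝ) : Prop where
  lt : t < t'
  clear : ∀ τ ∈ Ioo t t', Clear ε τ Z
  event : (t' = t + 1 ∧ Z' = Z ∧ Clear ε t' Z) ∨
    ∃ i j, Collides ε i j t' Z ∧ Z' = scatter ε i j t' Z

theorem gap_eq (Z : Phase d N) (t τ : ℝ) (k l : Fin N) :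
    freePos Z τ k - freePos Z τ l =
      (freePos Z t k - freePos Z t l) + (τ - t) • (Z.2 k - Z.2 l) := by
  simp only [freePos_apply]; module

theorem continuous_gap (Z : Phase d N) (k l : Fin N) :
    Continuous fun τ => ‖freePos Z τ k - freePos Z τ l‖ := by
  simp only [freePos_apply]; fun_prop

theorem incoming_of_clear_before {ε t t' : ℝ} (hε : 0 < ε) {Z : Phase d N} (ht : t < t')
    (h : ∀ τ ∈ Ioo t t', Clear ε τ Z) {k l : Fin N} (hc : Contact ε (freePos Z t') k l) :
    inner ℝ (freePos Z t' k - freePos Z t' l) (Z.2 k - Z.2 l) ≤ 0 := by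
  by_contra! hb
  set b := inner ℝ (freePos Z t' k - freePos Z t' l) (Z.2 k - Z.2 l) with hb'
  set u := Z.2 k - Z.2 l with hu
  set s := min ((t' - t) / 2) (b / (‖u‖ ^ 2 + 1)) with hs
  have hs0 : 0 < s := lt_min (by linarith) (by positivity)
  have hs1 : s < t' - t := (min_le_left _ _).trans_lt (by linarith)
  have hs2 : s * ‖u‖ ^ 2 ≤ b := by
    have : s * (‖u‖ ^ 2 + 1) ≤ b := (le_div_iff₀ (by positivity)).1 (min_le_right _ _)
    nlinarith
  have h1 := h (t' - s) ⟨by linarith, by linarith⟩ k l hc.1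
  rw [gap_eq Z t', ← hu] at h1
  have h2 := norm_add_smul_sq (freePos Z t' k - freePos Z t' l) u (t' - s - t')
  rw [hc.2, ← hb'] at h2
  nlinarith

theorem gap_lt_of_outgoing {ε t τ : ℝ} {Z : Phase d N} {k l : Fin N}
    (hτ : t < τ) (hc : ‖freePos Z t k - freePos Z t l‖ = ε)
    (ho : 0 < inner ℝ (freePos Z t k - freePos Z t l) (Z.2 k - Z.2 l)) :
    ε < ‖freePos Z τ k - freePos Z τ l‖ := by
  have h2 := norm_add_smul_sq (freePos Z t k - freePos Z t l) (Z.2 k - Z.2 l) (τ - t)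
  rw [← gap_eq, hc] at h2
  have h3 : 0 < (τ - t) * inner ℝ (freePos Z t k - freePos Z t l) (Z.2 k - Z.2 l) :=
    mul_pos (sub_pos.2 hτ) ho
  have h4 : 0 ≤ (τ - t) ^ 2 * ‖Z.2 k - Z.2 l‖ ^ 2 := by positivity
  refine lt_of_pow_lt_pow_left₀ 2 (norm_nonneg _) ?_
  linarith

theorem exists_step {ε t : ℝ} (hε : 0 < ε) {Z : Phase d N} (hR : Regular ε Z)
    (hO : Outgoing ε t Z) :
    ∃ Z' t', Step ε Z t Z' t' ∧ Outgoing ε t' Z' ∧ Regular ε Z' := by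
  set K : Set ℝ := Icc t (t + 1) ∩ ⋃ (k : Fin N), ⋃ (l : Fin N),
    {τ | k ≠ l ∧ ε < ‖freePos Z t k - freePos Z t l‖} ∩
      {τ | ‖freePos Z τ k - freePos Z τ l‖ ≤ ε} with hK
  have hKc : IsCompact K := by
    refine isCompact_Icc.inter_right (isClosed_iUnion_of_finite fun k =>
      isClosed_iUnion_of_finite fun l => isClosed_const.inter ?_)
    exact isClosed_le (continuous_gap Z k l) continuous_const
  have hclear : ∀ τ ∈ Ioc t (t + 1), τ ∉ K → Clear ε τ Z := by
    intro τ hτ hτK k l hkl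
    rcases hO k l hkl with h | ⟨h1, h2⟩
    · by_contra! hle
      exact hτK ⟨Ioc_subset_Icc_self hτ, mem_iUnion₂.2 ⟨k, l, ⟨hkl, h⟩, hle⟩⟩
    · exact gap_lt_of_outgoing hτ.1 h1 h2
  rcases K.eq_empty_or_nonempty with hKe | hKn
  · have hc : ∀ τ ∈ Ioc t (t + 1), Clear ε τ Z := fun τ hτ => hclear τ hτ (by simp [hKe])
    have h1 := hc (t + 1) ⟨by linarith, le_rfl⟩
    exact ⟨Z, t + 1, ⟨by linarith, fun τ hτ => hc τ (Ioo_subset_Ioc_self hτ), .inl ⟨rfl, rfl, h1⟩⟩,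
      fun k l hkl => .inl (h1 k l hkl), hR⟩
  · have hmem := hKc.sInf_mem hKn
    set t' := sInf K with ht'
    obtain ⟨⟨htt', ht'1⟩, hU⟩ := hmem
    obtain ⟨i, j, ⟨hij, hfar⟩, hle⟩ := mem_iUnion₂.1 hU
    have hle : ‖freePos Z t' i - freePos Z t' j‖ ≤ ε := hle
    have hlt : t < t' := lt_of_le_of_ne htt' fun h => by rw [← h] at hle; exact hfar.not_ge hle
    have hc : ∀ τ ∈ Ioo t t', Clear ε τ Z := fun τ hτ =>
      hclear τ ⟨hτ.1, hτ.2.le.trans ht'1⟩ fun hτK => hτ.2.not_ge (csInf_le hKc.bddBelow hτK)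
    have hge : ∀ k l, k ≠ l → ε ≤ ‖freePos Z t' k - freePos Z t' l‖ := by
      intro k l hkl
      have h1 : closure (Ioo t t') ⊆ {τ | ε ≤ ‖freePos Z τ k - freePos Z τ l‖} :=
        closure_minimal (fun τ hτ => (hc τ hτ k l hkl).le)
          (isClosed_le continuous_const (continuous_gap Z k l))
      rw [closure_Ioo hlt.ne] at h1
      exact h1 (right_mem_Icc.2 hlt.le)
    have hcon : Contact ε (freePos Z t') i j := ⟨hij, hle.antisymm (hge i j hij)⟩
    have hcol : Collides ε i j t' Z := by
      refine ⟨hcon, lt_of_le_of_ne (incoming_of_clear_before hε hlt hc hcon)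
        (hR.inner_ne_zero hcon), fun k l hkl => ?_⟩
      rcases (hge k l hkl).lt_or_eq with h | h
      · exact .inr (.inr h)
      · rcases hR.contact_unique hcon ⟨hkl, h.symm⟩ with h | h
        · exact .inl h
        · exact .inr (.inl h)
    exact ⟨_, t', ⟨hlt, hc, .inr ⟨i, j, hcol, rfl⟩⟩, hcol.outgoing hε, hR.scatter hε hcol⟩

/-- An orbit: the sequence of free flows that a configuration runs through, and the times when
they start. -/
structure IsOrbit (ε : ℝ) (Z : ℕ → Phase d N) (t : ℕ → ℝ) : Prop where
  zero : t 0 = 0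
  clear_zero : Clear ε 0 (Z 0)
  step : ∀ n, Step ε (Z n) (t n) (Z (n + 1)) (t (n + 1))

theorem exists_isOrbit {ε : ℝ} (hε : 0 < ε) {Z₀ : Phase d N} (hR : Regular ε Z₀)
    (h₀ : Z₀ ∈ domain d N ε) : ∃ Z t, Z 0 = Z₀ ∧ IsOrbit ε Z t := by
  have hc : Clear ε 0 Z₀ := fun k l hkl => by
    simpa [freePos_apply] using h₀ k l hkl
  let S := {p : Phase d N × ℝ // Outgoing ε p.2 p.1 ∧ Regular ε p.1}
  have hnext : ∀ p : S, ∃ q : S, Step ε p.1.1 p.1.2 q.1.1 q.1.2 := fun p => by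
    obtain ⟨Z', t', h1, h2, h3⟩ := exists_step hε p.2.2 p.2.1
    exact ⟨⟨(Z', t'), h2, h3⟩, h1⟩
  choose next hnext using hnext
  let p₀ : S := ⟨(Z₀, 0), fun k l hkl => .inl (hc k l hkl), hR⟩
  refine ⟨fun n => (next^[n] p₀).1.1, fun n => (next^[n] p₀).1.2, rfl, rfl, hc, fun n => ?_⟩
  rw [Function.iterate_succ_apply']
  exact hnext _

theorem Step.freePos_eq {ε t t' : ℝ} {Z Z' : Phase d N} (h : Step ε Z t Z' t') :
    freePos Z' t' = freePos Z t' := by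
  rcases h.event with ⟨_, rfl, _⟩ | ⟨i, j, _, rfl⟩
  · rfl
  · exact freePos_scatter ..

theorem Step.sum_norm_sq {ε t t' : ℝ} (hε : 0 < ε) {Z Z' : Phase d N} (h : Step ε Z t Z' t') :
    ∑ k, ‖Z'.2 k‖ ^ 2 = ∑ k, ‖Z.2 k‖ ^ 2 := by
  rcases h.event with ⟨_, rfl, _⟩ | ⟨i, j, hc, rfl⟩
  · rfl
  · exact hc.sum_norm_sq hε

theorem IsOrbit.strictMono {ε : ℝ} {Z : ℕ → Phase d N} {t : ℕ → ℝ} (h : IsOrbit ε Z t) :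
    StrictMono t :=
  strictMono_nat_of_lt_succ fun n => (h.step n).lt

open Filter Topology in
theorem IsOrbit.tendsto_atTop {ε : ℝ} (hε : 0 < ε) {Z : ℕ → Phase d N} {t : ℕ → ℝ}
    (h : IsOrbit ε Z t) : Tendsto t atTop atTop := by
  refine (tendsto_atTop_of_monotone h.strictMono.monotone).resolve_right ?_
  rintro ⟨T, hT⟩
  let p : ℕ → PiLp 2 fun _ : Fin N => Space d := fun n => WithLp.toLp 2 (freePos (Z n) (t n))
  let V : ℕ → PiLp 2 fun _ : Fin N => Space d := fun n => WithLp.toLp 2 (Z n).2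
  have hp : ∀ n, p (n + 1) = p n + (t (n + 1) - t n) • V n := fun n => by
    simp only [p, V]
    rw [(h.step n).freePos_eq, ← WithLp.toLp_smul, ← WithLp.toLp_add]
    congr 1
    simp only [freePos]
    module
  have hV : ∀ n, ‖V n‖ = ‖V 0‖ := fun n => by
    induction n with
    | zero => rfl
    | succ n ih =>
      rw [← ih, ← sq_eq_sq₀ (norm_nonneg _) (norm_nonneg _), PiLp.norm_sq_eq_of_L2,
        PiLp.norm_sq_eq_of_L2]
      exact (h.step n).sum_norm_sq hε
  have hlt : ∀ n, t n ≤ T := fun n => h.strictMono.monotone.ge_of_tendsto hT n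
  have hdist : ∀ n m, n ≤ m → dist (p n) (p m) ≤ ‖V 0‖ * (t m - t n) := by
    intro n m hm
    induction m, hm using Nat.le_induction with
    | base => simp
    | succ m hm ih =>
      have h1 : dist (p m) (p (m + 1)) = ‖V 0‖ * (t (m + 1) - t m) := by
        rw [hp, dist_self_add_right, norm_smul, hV, Real.norm_of_nonneg
          (sub_nonneg.2 (h.strictMono.monotone m.le_succ)), mul_comm]
      have := dist_triangle (p n) (p m) (p (m + 1))
      linarith
  have hcauchy : CauchySeq p := by
    refine cauchySeq_of_le_tendsto_0' (fun n => ‖V 0‖ * (T - t n)) (fun n m hnm => ?_) ?_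
    · exact (hdist n m hnm).trans
        (mul_le_mul_of_nonneg_left (sub_le_sub_right (hlt m) _) (norm_nonneg _))
    · simpa using (hT.const_sub T).const_mul ‖V 0‖
  obtain ⟨q, hq⟩ := cauchySeq_tendsto_of_complete hcauchy
  have hgap : ∀ᶠ n in atTop, ∀ i j : Fin N, ε < ‖q i - q j‖ → ε < ‖p n i - p n j‖ := by
    refine eventually_all.2 fun i => eventually_all.2 fun j => ?_
    by_cases hij : ε < ‖q i - q j‖
    · have hcont : Continuous fun x : PiLp 2 fun _ : Fin N => Space d => ‖x i - x j‖ := by fun_prop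
      exact ((hcont.tendsto q).comp hq |>.eventually_const_lt hij).mono fun n hn _ => hn
    · exact Eventually.of_forall fun n hn => absurd hn hij
  have hjump : ∀ᶠ n in atTop, 0 ≤ inner ℝ (p (n + 1) - q) (V (n + 1) - V n) := by
    filter_upwards [(tendsto_add_atTop_nat 1).eventually hgap] with n hn
    rcases (h.step n).event with ⟨_, h2, _⟩ | ⟨i, j, hc, h2⟩
    · simp [V, h2]
    · have hx : ‖q i - q j‖ ≤ ε := by
        by_contra! hlt
        have h3 := hn i j hlt
        simp only [p, (h.step n).freePos_eq] at h3
        exact h3.ne' hc.contact.2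
      have h4 := hc.sum_inner_nonneg hε (x := q.ofLp) hx
      rw [← h2, ← (h.step n).freePos_eq] at h4
      rw [PiLp.inner_apply]
      exact h4
  have hdt : Tendsto (fun n => t (n + 1) - t n) atTop (𝓝 0) := by
    simpa using (hT.comp (tendsto_add_atTop_nat 1)).sub hT
  obtain ⟨n, hn1, hn2⟩ := ((eventually_velocity_eq h.strictMono hT hp hV hq hjump).and
    (hdt.eventually_lt_const one_pos)).exists
  rcases (h.step n).event with ⟨h1, _⟩ | ⟨i, j, hc, h2⟩
  · rw [h1] at hn2; linarith
  · apply hc.vel_ne hε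
    rw [← h2]
    exact WithLp.toLp_injective 2 hn1

/-- The number `n` of the interval `(t n, t (n + 1)]` that contains `τ`. -/
def orbitIndex (t : ℕ → ℝ) (τ : ℝ) : ℕ := sInf {n | τ ≤ t (n + 1)}

/-- The positions along an orbit. -/
def orbitPos (Z : ℕ → Phase d N) (t : ℕ → ℝ) (τ : ℝ) : Fin N → Space d :=
  freePos (Z (orbitIndex t τ)) τ

/-- The velocities along an orbit, left-continuous at collisions. -/
def orbitVel (Z : ℕ → Phase d N) (t : ℕ → ℝ) (τ : ℝ) : Fin N → Space d :=
  (Z (orbitIndex t τ)).2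

theorem orbitIndex_eq {t : ℕ → ℝ} (ht : StrictMono t) {n : ℕ} {τ : ℝ}
    (hτ : τ ∈ Ioc (t n) (t (n + 1))) : orbitIndex t τ = n := by
  refine le_antisymm (Nat.sInf_le hτ.2) ?_
  by_contra! hlt
  have h1 : τ ≤ t (orbitIndex t τ + 1) := Nat.sInf_mem (s := {n | τ ≤ t (n + 1)}) ⟨n, hτ.2⟩
  exact hτ.1.not_ge (h1.trans (ht.monotone hlt))

theorem orbitIndex_eq_zero {t : ℕ → ℝ} {τ : ℝ} (hτ : τ ≤ t 1) : orbitIndex t τ = 0 :=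
  Nat.le_zero.1 (Nat.sInf_le hτ)

open Filter in
theorem exists_mem_Ico {t : ℕ → ℝ} (hT : Tendsto t atTop atTop) {τ : ℝ} (hτ : t 0 ≤ τ) :
    ∃ n, τ ∈ Ico (t n) (t (n + 1)) := by
  have hex : ∃ n, τ < t (n + 1) :=
    (((hT.comp (tendsto_add_atTop_nat 1)).eventually_gt_atTop τ)).exists
  classical
  refine ⟨Nat.find hex, ?_, Nat.find_spec hex⟩
  rcases h : Nat.find hex with _ | m
  · exact hτ
  · exact not_lt.1 (Nat.find_min hex (m := m) (by omega))

open Filter in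
theorem exists_mem_Ioc {t : ℕ → ℝ} (hT : Tendsto t atTop atTop) {τ : ℝ} (hτ : t 0 < τ) :
    ∃ n, τ ∈ Ioc (t n) (t (n + 1)) := by
  have hex : ∃ n, τ ≤ t (n + 1) :=
    (((hT.comp (tendsto_add_atTop_nat 1)).eventually_ge_atTop τ)).exists
  classical
  refine ⟨Nat.find hex, ?_, Nat.find_spec hex⟩
  rcases h : Nat.find hex with _ | m
  · exact hτ
  · exact not_le.1 (Nat.find_min hex (m := m) (by omega))

namespace IsOrbit

variable {ε : ℝ} {Z : ℕ → Phase d N} {t : ℕ → ℝ}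

theorem vel_eq (h : IsOrbit ε Z t) {n : ℕ} {τ : ℝ} (hτ : τ ∈ Ioc (t n) (t (n + 1))) :
    orbitVel Z t τ = (Z n).2 := by
  rw [orbitVel, orbitIndex_eq h.strictMono hτ]

theorem pos_eq (h : IsOrbit ε Z t) {n : ℕ} {τ : ℝ} (hτ : τ ∈ Icc (t n) (t (n + 1))) :
    orbitPos Z t τ = freePos (Z n) τ := by
  rcases hτ.1.eq_or_lt with rfl | hlt
  · cases n with
    | zero => rw [orbitPos, orbitIndex_eq_zero hτ.2]
    | succ m =>
      rw [orbitPos, orbitIndex_eq h.strictMono ⟨h.strictMono m.lt_succ_self, le_rfl⟩,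
        (h.step m).freePos_eq]
  · rw [orbitPos, orbitIndex_eq h.strictMono ⟨hlt, hτ.2⟩]

theorem vel_zero (h : IsOrbit ε Z t) : orbitVel Z t 0 = (Z 0).2 := by
  rw [orbitVel, orbitIndex_eq_zero]
  rw [← h.zero]; exact h.strictMono.monotone zero_le_one

theorem pos_zero (h : IsOrbit ε Z t) : orbitPos Z t 0 = (Z 0).1 := by
  rw [h.pos_eq (n := 0)]
  · simp [freePos]
  · rw [← h.zero]; exact left_mem_Icc.2 (h.strictMono.monotone zero_le_one)

theorem clear_of_mem_Ioo (h : IsOrbit ε Z t) {n : ℕ} {τ : ℝ} (hτ : τ ∈ Ioo (t n) (t (n + 1)))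
    (i j : Fin N) : ¬Contact ε (orbitPos Z t τ) i j := by
  rw [h.pos_eq (Ioo_subset_Icc_self hτ)]
  exact ((h.step n).clear τ hτ).not_contact i j

theorem clear_at_zero (h : IsOrbit ε Z t) (i j : Fin N) : ¬Contact ε (orbitPos Z t 0) i j := by
  have h1 := h.clear_zero.not_contact i j
  rwa [h.pos_zero, show (Z 0).1 = freePos (Z 0) 0 by simp [freePos]]

theorem pos_succ (h : IsOrbit ε Z t) (n : ℕ) :
    orbitPos Z t (t (n + 1)) = freePos (Z n) (t (n + 1)) :=
  h.pos_eq ⟨(h.step n).lt.le, le_rfl⟩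

theorem vel_succ (h : IsOrbit ε Z t) (n : ℕ) : orbitVel Z t (t (n + 1)) = (Z n).2 :=
  h.vel_eq ⟨(h.step n).lt, le_rfl⟩

theorem eq_of_no_contact (h : IsOrbit ε Z t) {n : ℕ}
    (hn : ∀ i j, ¬Contact ε (orbitPos Z t (t (n + 1))) i j) : Z (n + 1) = Z n := by
  rcases (h.step n).event with ⟨_, h2, _⟩ | ⟨i, j, hc, _⟩
  · exact h2
  · refine absurd ?_ (hn i j)
    rw [h.pos_succ]; exact hc.contact

open Filter in
theorem exists_collides (h : IsOrbit ε Z t) (hT : Tendsto t atTop atTop) {τ : ℝ} (hτ : 0 ≤ τ)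
    {i j : Fin N} (hc : Contact ε (orbitPos Z t τ) i j) :
    ∃ n k l, τ = t (n + 1) ∧ Collides ε k l τ (Z n) := by
  have h0 : t 0 < τ := by
    rw [h.zero]
    refine lt_of_le_of_ne hτ fun h0 => ?_
    rw [← h0] at hc
    exact h.clear_at_zero i j hc
  obtain ⟨n, hn⟩ := exists_mem_Ioc hT h0
  rcases hn.2.eq_or_lt with rfl | hlt
  · rw [h.pos_succ] at hc
    rcases (h.step n).event with ⟨_, _, h3⟩ | ⟨k, l, hkl, _⟩
    · exact absurd hc (h3.not_contact i j)
    · exact ⟨n, k, l, rfl, hkl⟩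
  · exact absurd hc (h.clear_of_mem_Ioo ⟨hn.1, hlt⟩ i j)

theorem reflects_of_no_contact {x v : Fin N → Space d} (h : ∀ i j, ¬Contact ε x i j) :
    Reflects ε x v v :=
  ⟨fun i j hij => absurd hij (h i j), fun _ _ => rfl⟩

theorem reflects (h : IsOrbit ε Z t) {n : ℕ} {s : ℝ} (hs : s ∈ Ico (t n) (t (n + 1))) :
    Reflects ε (orbitPos Z t s) (orbitVel Z t s) (Z n).2 := by
  rcases hs.1.eq_or_lt with rfl | hlt
  · cases n with
    | zero =>
      rw [h.zero, h.vel_zero]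
      exact reflects_of_no_contact h.clear_at_zero
    | succ m =>
      rw [h.pos_succ, h.vel_succ]
      rcases (h.step m).event with ⟨_, h2, h3⟩ | ⟨i, j, hc, h2⟩
      · rw [h2]
        exact reflects_of_no_contact h3.not_contact
      · rw [h2]
        exact hc.reflects
  · rw [h.vel_eq ⟨hlt, hs.2.le⟩]
    exact reflects_of_no_contact (h.clear_of_mem_Ioo ⟨hlt, hs.2⟩)

theorem continuousOn (h : IsOrbit ε Z t) (n : ℕ) :
    ContinuousOn (orbitPos Z t) (Icc 0 (t n)) := by
  induction n with
  | zero => simp [h.zero]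
  | succ n ih =>
    have h0 : 0 ≤ t n := by rw [← h.zero]; exact h.strictMono.monotone n.zero_le
    rw [← Icc_union_Icc_eq_Icc h0 (h.step n).lt.le]
    refine ih.union_of_isClosed ?_ isClosed_Icc isClosed_Icc
    have : Continuous (freePos (Z n)) := by unfold freePos; fun_prop
    exact this.continuousOn.congr fun τ hτ => h.pos_eq hτ

open Filter in
theorem exclusion (h : IsOrbit ε Z t) (hT : Tendsto t atTop atTop) {τ : ℝ} (hτ : 0 ≤ τ)
    {i j : Fin N} (hij : i ≠ j) : ε ≤ ‖orbitPos Z t τ i - orbitPos Z t τ j‖ := by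
  rcases hτ.eq_or_lt with rfl | h0
  · have h1 := h.clear_zero i j hij
    rw [h.pos_zero]
    simpa [freePos] using h1.le
  · rw [← h.zero] at h0
    obtain ⟨n, hn⟩ := exists_mem_Ioc hT h0
    rw [h.pos_eq (Ioc_subset_Icc_self hn)]
    rcases hn.2.eq_or_lt with rfl | hlt
    · rcases (h.step n).event with ⟨_, _, h3⟩ | ⟨k, l, hkl, _⟩
      · exact (h3 i j hij).le
      · exact hkl.le hij
    · exact ((h.step n).clear τ ⟨hn.1, hlt⟩ i j hij).le

open Filter in
theorem not_pathological (h : IsOrbit ε Z t) (hε : 0 < ε) (hT : Tendsto t atTop atTop) (T : ℝ) :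
    ¬Pathological ε T (orbitPos Z t) (orbitVel Z t) := by
  rintro (⟨τ, hτ, i, j, k, hjk, hij, hik⟩ | ⟨τ, hτ, i, j, hij, hg⟩ | hinf)
  · obtain ⟨n, a, b, rfl, hc⟩ := h.exists_collides hT hτ.1 hij
    rw [h.pos_succ] at hij hik
    have := hc.contact_iff hij
    have := hc.contact_iff hik
    have := hc.contact.1
    grind
  · obtain ⟨n, a, b, rfl, hc⟩ := h.exists_collides hT hτ.1 hij
    rw [h.pos_succ, h.vel_succ] at hg
    rw [h.pos_succ] at hij
    rw [normalDir_of_contact hij, real_inner_smul_left] at hg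
    have hg := (mul_eq_zero.1 hg).resolve_left (inv_ne_zero hε.ne')
    have hlt := hc.incoming
    rcases hc.contact_iff hij with ⟨rfl, rfl⟩ | ⟨rfl, rfl⟩
    · exact hlt.ne hg
    · rw [← neg_sub, ← neg_sub ((Z n).2 j), inner_neg_neg] at hg
      exact hlt.ne hg
  · obtain ⟨M, hM⟩ := (hT.eventually_gt_atTop T).exists
    refine hinf (((finite_Iio M).image t).subset ?_)
    rintro τ ⟨hτ, i, j, hij⟩
    obtain ⟨n, a, b, rfl, hc⟩ := h.exists_collides hT hτ.1 hij
    exact ⟨n + 1, h.strictMono.lt_iff_lt.1 (hτ.2.trans_lt hM), rfl⟩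

theorem eq_on_of_no_contact (h : IsOrbit ε Z t) {s s' : ℝ}
    (hc : ∀ τ ∈ Ioo s s', ∀ i j, ¬Contact ε (orbitPos Z t τ) i j) {n : ℕ} (hn : s < t (n + 1))
    {m : ℕ} (hnm : n ≤ m) (hm : t m < s') : Z m = Z n := by
  induction m, hnm using Nat.le_induction with
  | base => rfl
  | succ m hnm ih =>
    rw [← ih ((h.step m).lt.trans hm)]
    refine h.eq_of_no_contact (hc _ ⟨?_, hm⟩)
    exact hn.trans_le (h.strictMono.monotone (by omega))

open Filter in
theorem isTrajectory (h : IsOrbit ε Z t) (hε : 0 < ε) (hT : Tendsto t atTop atTop) (T : ℝ) :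
    IsTrajectory ε T (Z 0) (orbitPos Z t) (orbitVel Z t) where
  init_pos := h.pos_zero
  init_vel := h.vel_zero
  cont := by
    obtain ⟨M, hM⟩ := (hT.eventually_ge_atTop T).exists
    exact (h.continuousOn M).mono (Icc_subset_Icc_right hM)
  exclusion τ hτ i j hij := h.exclusion hT hτ.1 hij
  free_flow s s' hs hss' _ hc := by
    obtain ⟨n, hn⟩ := exists_mem_Ico hT (h.zero.trans_le hs)
    refine ⟨_, h.reflects hn, fun τ hτ => ?_⟩
    have h0 : t 0 < τ := by rw [h.zero]; exact hs.trans_lt hτ.1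
    obtain ⟨m, hm⟩ := exists_mem_Ioc hT h0
    have hnm : n ≤ m := by
      have := h.strictMono.lt_iff_lt.1 ((hn.1.trans_lt hτ.1).trans_le hm.2)
      omega
    have hZ := h.eq_on_of_no_contact hc hn.2 hnm (hm.1.trans_le hτ.2)
    refine ⟨by rw [h.vel_eq hm, hZ], fun i => ?_⟩
    rw [h.pos_eq (Ioc_subset_Icc_self hm), hZ, h.pos_eq (Ico_subset_Icc_self hn), ← freePos_add]
    congr 1; ring
  regular T' _ := h.not_pathological hε hT T'

end IsOrbit

theorem Reflects.unique {ε : ℝ} {x v w w' : Fin N → Space d} (h : Reflects ε x v w)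
    (h' : Reflects ε x v w') : w = w' := by
  funext i
  by_cases hi : ∃ j, Contact ε x i j
  · obtain ⟨j, hj⟩ := hi
    rw [(h.1 i j hj).1, (h'.1 i j hj).1]
  · push Not at hi
    rw [h.2 i hi, h'.2 i hi]

/-- Two trajectories that agree at time `a` agree up to time `b`, if one of them has no contact
between `a` and `b`. -/
theorem IsTrajectory.eq_on_Ioc {ε T : ℝ} {Z : Phase d N} {x v x' v' : ℝ → Fin N → Space d}
    (h : IsTrajectory ε T Z x v) (h' : IsTrajectory ε T Z x' v') {a b : ℝ} (ha : 0 ≤ a)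
    (hab : a < b) (hb : b ≤ T) (hx : x' a = x a) (hv : v' a = v a)
    (hc : ∀ τ ∈ Ioo a b, ∀ i j, ¬Contact ε (x τ) i j) {τ : ℝ} (hτ : τ ∈ Ioc a b) :
    x' τ = x τ ∧ v' τ = v τ := by
  have key : ∀ c ≤ b, a < c → (∀ τ ∈ Ioo a c, ∀ i j, ¬Contact ε (x' τ) i j) →
      ∀ τ ∈ Ioc a c, x' τ = x τ ∧ v' τ = v τ := by
    intro c hcb hac hc' τ hτ
    obtain ⟨w, hw, hflow⟩ := h.free_flow a b ha hab hb hc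
    obtain ⟨w', hw', hflow'⟩ := h'.free_flow a c ha hac (hcb.trans hb) hc'
    rw [hx, hv] at hw'
    obtain rfl := hw.unique hw'
    obtain ⟨h1, h2⟩ := hflow τ ⟨hτ.1, hτ.2.trans hcb⟩
    obtain ⟨h1', h2'⟩ := hflow' τ hτ
    refine ⟨funext fun i => ?_, h1'.trans h1.symm⟩
    rw [h2, h2', hx]
  refine key b le_rfl hab ?_ τ hτ
  by_contra! hcon
  obtain ⟨σ, hσ, i, j, hij⟩ := hcon
  have hfin : (collisionTimes ε σ x').Finite := by
    by_contra hinf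
    exact h'.regular σ (hσ.2.trans_le hb) (.inr (.inr hinf))
  have hfin' : (collisionTimes ε σ x' ∩ Ioi a).Finite := hfin.inter_of_left _
  have hne : (collisionTimes ε σ x' ∩ Ioi a).Nonempty :=
    ⟨σ, ⟨⟨ha.trans hσ.1.le, le_rfl⟩, i, j, hij⟩, hσ.1⟩
  obtain ⟨ρ, ⟨⟨hρ, k, l, hkl⟩, haρ⟩, hmin⟩ := hfin'.exists_minimal hne
  have haρ : a < ρ := haρ
  have hfree : ∀ τ ∈ Ioo a ρ, ∀ i j, ¬Contact ε (x' τ) i j := by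
    intro τ hτ i j hij
    exact hτ.2.not_ge
      (hmin ⟨⟨⟨ha.trans hτ.1.le, hτ.2.le.trans hρ.2⟩, i, j, hij⟩, hτ.1⟩ hτ.2.le)
  have hρb : ρ < b := hρ.2.trans_lt hσ.2
  rw [(key ρ hρb.le haρ hfree ρ ⟨haρ, le_rfl⟩).1] at hkl
  exact hc ρ ⟨haρ, hρb⟩ k l hkl

theorem Regular.globallyDefined {ε : ℝ} (hε : 0 < ε) {Z₀ : Phase d N} (hR : Regular ε Z₀)
    (h₀ : Z₀ ∈ domain d N ε) : GloballyDefined ε Z₀ := by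
  obtain ⟨Z, t, rfl, h⟩ := exists_isOrbit hε hR h₀
  have hT := h.tendsto_atTop hε
  refine ⟨orbitPos Z t, orbitVel Z t, fun T _ => h.isTrajectory hε hT T, ?_⟩
  intro T _ x' v' h' τ hτ
  have hind : ∀ n, ∀ σ ∈ Icc 0 (t n), σ ≤ T →
      x' σ = orbitPos Z t σ ∧ v' σ = orbitVel Z t σ := by
    intro n
    induction n with
    | zero =>
      intro σ hσ _
      rw [h.zero, Icc_self, mem_singleton_iff] at hσ
      rw [hσ, h'.init_pos, h'.init_vel, h.pos_zero, h.vel_zero]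
      exact ⟨rfl, rfl⟩
    | succ n ih =>
      intro σ hσ hσT
      rcases le_or_gt σ (t n) with hle | hlt
      · exact ih σ ⟨hσ.1, hle⟩ hσT
      · have h0 : 0 ≤ t n := by rw [← h.zero]; exact h.strictMono.monotone n.zero_le
        obtain ⟨hx, hv⟩ := ih (t n) ⟨h0, le_rfl⟩ (hlt.le.trans hσT)
        exact (h.isTrajectory hε hT T).eq_on_Ioc h' h0 hlt hσT hx hv
          (fun ρ hρ => h.clear_of_mem_Ioo ⟨hρ.1, hρ.2.trans_le hσ.2⟩) ⟨hlt, le_rfl⟩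
  obtain ⟨M, hM⟩ := (hT.eventually_ge_atTop τ).exists
  exact hind M τ ⟨hτ.1, hM⟩ hτ.2

theorem GloballyDefined.not_leadsToPathological {ε : ℝ} {Z : Phase d N}
    (h : GloballyDefined ε Z) : ¬LeadsToPathological ε Z := by
  rintro ⟨T, hT, x', v', h', hpath⟩
  obtain ⟨x, v, hx, huniq⟩ := h
  have heq := huniq T hT x' v' h'
  refine (hx (T + 1) (by linarith)).regular T (by linarith) ?_
  rcases hpath with ⟨t, ht, hm⟩ | ⟨t, ht, hg⟩ | hinf
  · exact .inl ⟨t, ht, (heq t ht).1 ▸ hm⟩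
  · exact .inr (.inl ⟨t, ht, (heq t ht).1 ▸ (heq t ht).2 ▸ hg⟩)
  · refine .inr (.inr (hinf.mono ?_))
    rintro t ⟨ht, i, j, hij⟩
    exact ⟨ht, i, j, (heq t ht).1 ▸ hij⟩

theorem measurePreserving_reverse : MeasurePreserving (reverse : Phase d N → Phase d N) :=
  (MeasurePreserving.id (volume : Measure (Fin N → Space d))).prod
    (volume_preserving_pi fun _ => (LinearIsometryEquiv.neg ℝ (E := Space d)).measurePreserving)

theorem ae_globallyDefined {ε : ℝ} (hε : 0 < ε) : ∀ᵐ Z : Phase d N, Z ∈ domain d N ε →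
    GloballyDefined ε Z ∧ GloballyDefined ε (reverse Z) := by
  filter_upwards [ae_regular hε,
    measurePreserving_reverse.quasiMeasurePreserving.ae (ae_regular hε)] with Z h1 h2 hZ
  exact ⟨h1.globallyDefined hε hZ, h2.globallyDefined hε hZ⟩

end HardSphere

end

theorem mainTheorem9 (d N : ℕ) (ε : ℝ) (hε : 0 < ε) :
    volume {Z : HardSphere.Phase d N | Z ∈ HardSphere.domain d N ε ∧
      (HardSphere.LeadsToPathological ε Z ∨
        HardSphere.LeadsToPathological ε (HardSphere.reverse Z))} = 0 ∧
    ∀ᵐ Z : HardSphere.Phase d N, Z ∈ HardSphere.domain d N ε →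
      HardSphere.GloballyDefined ε Z ∧ HardSphere.GloballyDefined ε (HardSphere.reverse Z) := by
  refine ⟨?_, HardSphere.ae_globallyDefined hε⟩
  rw [measure_eq_zero_iff_ae_notMem]
  filter_upwards [HardSphere.ae_globallyDefined hε] with Z hZ h
  obtain ⟨h1, h2⟩ := hZ h.1
  exact h.2.elim h1.not_leadsToPathological h2.not_leadsToPathological
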